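/- For an integer $k\ge 1$, integers $h_1,\dots,h_k\ge 0$ and real $x$, let $$\pi_{2h_1,\dots,2h_k}(x)=\bigl|\{p\le x:\ p,\ p+2h_1,\dots,p+2h_k \text{ are all prime}\}\bigr|,$$ and let $M=M(h_1,\dots,h_k)=\max\{h_1,\dots,h_k\}$. **Theorem.** Let $k\ge 1$ be an integer, let $C>1/2$ be a constant, and let $E=E(x)$ be a real function such that $E(x)\ge C\log x$ for all sufficiently large $x$ and $E(x)=o\bigl(x/\log^{k+1}x\bigr)$ as $x\to\infty$. Then $$\frac{k+1}{2^k\lfloor E\rfloor^{k+1}}\sum_{\substack{0\le h_1,\dots,h_k\le E\\ (h_1,\dots,h_k)\ne(0,\dots,0)}}\bigl(\lfloor E\rfloor-M\bigr)\,\pi_{2h_1,\dots,2h_k}(x)\ \ge\ \Bigl(1-\frac{1}{(2C)^k}\Bigr)\frac{x}{\log^{k+1}x}\,(1+o(1)),$$ where $f(x)\ge g(x)(1+o(1))$ means that for every $\varepsilon>0$ one has $f(x)\ge(1-\varepsilon)g(x)$ for all sufficiently large $x$. -/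

import Mathlib

/-- `π_{d₁,…,d_k}(x)`: the number of primes `p ≤ x` such that
`p + d₁, …, p + d_k` are all prime as well. -/
noncomputable def primeTupleCount {k : ℕ} (d : Fin k → ℕ) (x : ℝ) : ℕ :=
  ((Finset.Iic ⌊x⌋₊).filter fun p => p.Prime ∧ ∀ i, (p + d i).Prime).card

/-- `M(h₁,…,h_k) = max {h₁,…,h_k}` (used for `k ≥ 1`). -/
def tupleMax {k : ℕ} (h : Fin k → ℕ) : ℕ :=
  Finset.univ.sup h

/-- The tuples `(h₁,…,h_k)` of integers with `0 ≤ h_i ≤ N`, not all zero. -/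
def shiftTuples (k N : ℕ) : Finset (Fin k → ℕ) :=
  (Fintype.piFinset fun _ : Fin k => Finset.Iic N).filter fun h => ∃ i, h i ≠ 0

/-- `(k+1) / (2^k ⌊E⌋^(k+1)) * ∑_h (⌊E⌋ - M(h)) π_{2h₁,…,2h_k}(x)`. -/
noncomputable def weightedTupleAverage (k : ℕ) (E x : ℝ) : ℝ :=
  ((k : ℝ) + 1) / (2 ^ k * (⌊E⌋₊ : ℝ) ^ (k + 1)) *
    ∑ h ∈ shiftTuples k ⌊E⌋₊,
      ((⌊E⌋₊ : ℝ) - (tupleMax h : ℝ)) * (primeTupleCount (fun i => 2 * h i) x : ℝ)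

/-! Put N = ⌊E⌋ and let P be the number of odd primes up to x. Slide a window of length N over the
halves ⌊p/2⌋ of these primes, and let c_j be the number of primes caught by the j-th window. Each
prime is caught N times, so ∑ c_j = N·P over about x/2 + N windows, and the power mean inequality
bounds ∑ c_j^(k+1) from below (`pow_sum_div_card_le_sum_pow`).

The same sum counts (k+1)-tuples of primes sharing a window. Constant tuples contribute at most N·P.
A nonconstant one has a least entry p in one of k+1 positions and other entries p + 2h_l, and it
fits in N - M(h) windows; this produces the weights and the factor k+1
(`sum_card_halfWindow_pow_le`). Comparing the two bounds gives
`card_oddPrimesLE_mul_sub_le_weightedTupleAverage`. The term (1/(2N))^k there comes from the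
constant tuples and, since N is at least about C log x, costs at most the fraction 1/(2C)^k.

The arithmetic input is P ≥ (1 - o(1)) x/log x. It is derived in Wiener–Ikehara style: the Laplace
transform of ψ(eᵗ)e⁻ᵗ - 1 extends continuously to the imaginary axis, so Fejér means of this
function tend to 0, and monotonicity of ψ turns the averaged statement into a pointwise lower bound.
-/

open MeasureTheory Filter Topology Set

/-! ### The Fejér kernel and its Fourier representation -/

/-- The Fejér kernel on the line, `(sin (v / 2) / (v / 2)) ^ 2`. -/
noncomputable def fejerKernel (v : ℝ) : ℝ := Real.sinc (v / 2) ^ 2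

lemma continuous_fejerKernel : Continuous fejerKernel := by
  unfold fejerKernel
  exact (Real.continuous_sinc.comp (by fun_prop)).pow 2

lemma fejerKernel_nonneg (v : ℝ) : 0 ≤ fejerKernel v := sq_nonneg _

lemma fejerKernel_zero : fejerKernel 0 = 1 := by simp [fejerKernel]

/-- The constant 5 is the sum of the bounds K ≤ 1 and v²K ≤ 4. -/
lemma fejerKernel_le (v : ℝ) : fejerKernel v ≤ 5 * (1 + v ^ 2)⁻¹ := by
  have h1 : fejerKernel v ≤ 1 := by
    unfold fejerKernel
    exact (sq_le_one_iff_abs_le_one _).2 (Real.abs_sinc_le_one _)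
  have h2 : v ^ 2 * fejerKernel v ≤ 4 := by
    rcases eq_or_ne v 0 with rfl | hv
    · simp
    · have : v ^ 2 * fejerKernel v = 4 * Real.sin (v / 2) ^ 2 := by
        rw [fejerKernel, Real.sinc_of_ne_zero (by positivity)]
        field_simp
        ring
      rw [this]
      nlinarith [Real.sin_sq_le_one (v / 2)]
  rw [← div_eq_mul_inv, le_div_iff₀ (by positivity)]
  linarith

lemma integrable_fejerKernel : Integrable fejerKernel :=
  (integrable_inv_one_add_sq.const_mul 5).mono' continuous_fejerKernel.aestronglyMeasurable
    (.of_forall fun v => by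
      rw [Real.norm_of_nonneg (fejerKernel_nonneg v)]; exact fejerKernel_le v)

lemma integral_fejerKernel_pos : 0 < ∫ v, fejerKernel v :=
  integral_pos_of_integrable_nonneg_nonzero (x := 0) continuous_fejerKernel integrable_fejerKernel
    fejerKernel_nonneg (by simp [fejerKernel_zero])

lemma integrable_fejerKernel_comp {l : ℝ} (hl : 0 < l) (y : ℝ) :
    Integrable fun t => fejerKernel (l * (y - t)) :=
  (integrable_fejerKernel.comp_mul_left' hl.ne').comp_sub_left y

lemma integral_fejerKernel_comp {l : ℝ} (hl : 0 < l) (y : ℝ) :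
    ∫ t, fejerKernel (l * (y - t)) = l⁻¹ * ∫ v, fejerKernel v := by
  rw [integral_sub_left_eq_self (fun t => fejerKernel (l * t)) volume y,
    Measure.integral_comp_mul_left, abs_of_pos (inv_pos.2 hl), smul_eq_mul]

/-- The Fejér kernel is the Fourier transform of the triangle function. -/
lemma fejerKernel_eq_integral (v : ℝ) :
    (fejerKernel v : ℂ) =
      ∫ u in (-1 : ℝ)..1, ((1 - |u| : ℝ) : ℂ) * Complex.exp (Complex.I * (u * v)) := by
  have hint : ∀ a b : ℝ, IntervalIntegrable
      (fun u : ℝ => ((1 - |u| : ℝ) : ℂ) * Complex.exp (Complex.I * (u * v))) volume a b :=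
    fun a b => Continuous.intervalIntegrable (by fun_prop) a b
  have e0 : ∫ u in (-1 : ℝ)..0, ((1 - |u| : ℝ) : ℂ) * Complex.exp (Complex.I * (u * v)) =
      ∫ u in (-1 : ℝ)..0, (1 + (u : ℂ)) * Complex.exp (Complex.I * (u * v)) := by
    refine intervalIntegral.integral_congr fun u hu => ?_
    rw [uIcc_of_le (by norm_num)] at hu
    simp [abs_of_nonpos hu.2]
  have e1 : ∫ u in (0 : ℝ)..1, ((1 - |u| : ℝ) : ℂ) * Complex.exp (Complex.I * (u * v)) =
      ∫ u in (0 : ℝ)..1, (1 - (u : ℂ)) * Complex.exp (Complex.I * (u * v)) := by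
    refine intervalIntegral.integral_congr fun u hu => ?_
    rw [uIcc_of_le (by norm_num)] at hu
    simp [abs_of_nonneg hu.1]
  rw [← intervalIntegral.integral_add_adjacent_intervals (hint (-1) 0) (hint 0 1), e0, e1]
  rcases eq_or_ne v 0 with rfl | hv
  · have i1 : ∫ u in (-1 : ℝ)..0, (1 + (u : ℂ)) = 1 / 2 := by
      have : ∫ u in (-1 : ℝ)..0, (1 + u) = 1 / 2 := by
        rw [intervalIntegral.integral_add (by simp) (by simp)]; norm_num
      rw [← Complex.ofReal_one, ← Complex.ofReal_ofNat, ← Complex.ofReal_div, ← this,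
        ← intervalIntegral.integral_ofReal]
      simp
    have i2 : ∫ u in (0 : ℝ)..1, (1 - (u : ℂ)) = 1 / 2 := by
      have : ∫ u in (0 : ℝ)..1, (1 - u) = 1 / 2 := by
        rw [intervalIntegral.integral_sub (by simp) (by simp)]; norm_num
      rw [← Complex.ofReal_one, ← Complex.ofReal_ofNat, ← Complex.ofReal_div, ← this,
        ← intervalIntegral.integral_ofReal]
      simp
    simp only [Complex.ofReal_zero, mul_zero, Complex.exp_zero, mul_one, i1, i2, fejerKernel_zero]
    norm_num
  have hv' : (v : ℂ) ≠ 0 := by exact_mod_cast hv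
  set a : ℂ := Complex.I * v with ha
  have ha0 : a ≠ 0 := mul_ne_zero Complex.I_ne_zero hv'
  have hexp : ∀ u : ℝ, Complex.exp (Complex.I * (u * v)) = Complex.exp (a * u) := fun u => by
    rw [ha]; ring_nf
  simp_rw [hexp]
  have hd : ∀ u : ℝ, HasDerivAt (fun u : ℝ => Complex.exp (a * u)) (a * Complex.exp (a * u)) u := by
    intro u
    have := ((Complex.ofRealCLM.hasDerivAt (x := u)).const_mul a).cexp
    simpa [mul_comm] using this
  have hid : ∀ u : ℝ, HasDerivAt (fun u : ℝ => (u : ℂ)) 1 u := fun u => by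
    exact Complex.ofRealCLM.hasDerivAt (x := u)
  have i1 : ∫ u in (-1 : ℝ)..0, (1 + (u : ℂ)) * Complex.exp (a * u) =
      1 / a - 1 / a ^ 2 + Complex.exp (-a) / a ^ 2 := by
    rw [intervalIntegral.integral_eq_sub_of_hasDerivAt
      (f := fun u : ℝ => (1 + (u : ℂ)) / a * Complex.exp (a * u) - 1 / a ^ 2 * Complex.exp (a * u))]
    · simp; ring
    · intro u _
      convert! ((((hid u).const_add 1).div_const a).mul (hd u)).sub ((hd u).const_mul (1 / a ^ 2))
        using 1
      field_simp
      ring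
    · exact Continuous.intervalIntegrable (by fun_prop) _ _
  have i2 : ∫ u in (0 : ℝ)..1, (1 - (u : ℂ)) * Complex.exp (a * u) =
      Complex.exp a / a ^ 2 - 1 / a - 1 / a ^ 2 := by
    rw [intervalIntegral.integral_eq_sub_of_hasDerivAt
      (f := fun u : ℝ => (1 - (u : ℂ)) / a * Complex.exp (a * u) + 1 / a ^ 2 * Complex.exp (a * u))]
    · simp; ring
    · intro u _
      convert! ((((hid u).const_sub 1).div_const a).mul (hd u)).add ((hd u).const_mul (1 / a ^ 2))
        using 1
      field_simp
      ring
    · exact Continuous.intervalIntegrable (by fun_prop) _ _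
  rw [i1, i2]
  have h2 : Complex.exp a + Complex.exp (-a) = 2 * Complex.cos v := by
    rw [Complex.cos, ha]; ring_nf
  have h3 : Complex.cos v = 1 - 2 * Complex.sin (v / 2) ^ 2 := by
    have := Complex.cos_two_mul (v / 2 : ℂ)
    rw [Complex.cos_sq', mul_div_cancel₀ _ (two_ne_zero)] at this
    rw [this]; ring
  have h4 : a ^ 2 = -(v : ℂ) ^ 2 := by rw [ha, mul_pow, Complex.I_sq]; ring
  have : 1 / a - 1 / a ^ 2 + Complex.exp (-a) / a ^ 2 +
      (Complex.exp a / a ^ 2 - 1 / a - 1 / a ^ 2) =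
      (Complex.exp a + Complex.exp (-a) - 2) / a ^ 2 := by ring
  rw [this, h2, h3, h4, fejerKernel, Real.sinc_of_ne_zero (by positivity)]
  push_cast
  field_simp
  ring

lemma abs_one_sub_abs_le_one {u : ℝ} (hu : u ∈ Ioc (-1 : ℝ) 1) : abs (1 - abs u) ≤ 1 := by
  have : |u| ≤ 1 := abs_le.2 ⟨hu.1.le, hu.2⟩
  rw [abs_of_nonneg (by linarith)]
  linarith [abs_nonneg u]

/-! ### Fejér means and boundary values of the Laplace transform -/

section FejerMean

variable {g : ℝ → ℝ} {B : ℝ} {H : ℂ → ℂ}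

/-- Fubini: for σ > 0 the factor e^(-σt) makes the double integral absolutely convergent, and the
inner integral over u is the Fejér kernel. -/
lemma integral_laplace_mul_triangle (hg : Measurable g) (hB : ∀ t, |g t| ≤ B)
    (hH : ∀ s : ℂ, 0 < s.re → H s = ∫ t in Ioi (0 : ℝ), (g t : ℂ) * Complex.exp (-(s * t)))
    (l y : ℝ) {σ : ℝ} (hσ : 0 < σ) :
    ∫ u in (-1 : ℝ)..1, ((1 - |u| : ℝ) : ℂ) * Complex.exp (Complex.I * (u * (l * y))) *
        H (σ + Complex.I * (l * u)) =
      ∫ t in Ioi (0 : ℝ), ((g t * Real.exp (-(σ * t)) * fejerKernel (l * (y - t)) : ℝ) : ℂ) := by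
  have hB0 : 0 ≤ B := (abs_nonneg _).trans (hB 0)
  have hre : ∀ u : ℝ, 0 < ((σ : ℂ) + Complex.I * (l * u)).re := fun u => by simpa using hσ
  calc
    _ = ∫ u in (-1 : ℝ)..1, ∫ t in Ioi (0 : ℝ),
          ((1 - |u| : ℝ) : ℂ) * Complex.exp (Complex.I * (u * (l * y))) *
            ((g t : ℂ) * Complex.exp (-((σ + Complex.I * (l * u)) * t))) := by
      refine intervalIntegral.integral_congr fun u _ => ?_
      simp only [hH _ (hre u)]
      rw [integral_const_mul]
    _ = ∫ t in Ioi (0 : ℝ), ∫ u in (-1 : ℝ)..1,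
          ((1 - |u| : ℝ) : ℂ) * Complex.exp (Complex.I * (u * (l * y))) *
            ((g t : ℂ) * Complex.exp (-((σ + Complex.I * (l * u)) * t))) := by
      refine intervalIntegral_integral_swap ?_
      have hb : Integrable (fun z : ℝ × ℝ => (1 : ℝ) * (B * Real.exp (-σ * z.2)))
          ((volume.restrict (uIoc (-1 : ℝ) 1)).prod (volume.restrict (Ioi (0 : ℝ)))) :=
        Integrable.mul_prod (f := fun _ : ℝ => (1 : ℝ)) (g := fun t : ℝ => B * Real.exp (-σ * t))
          (integrableOn_const (by simp [uIoc_of_le]))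
          ((exp_neg_integrableOn_Ioi 0 hσ).const_mul B)
      refine hb.mono' ?_ ?_
      · have : Measurable fun z : ℝ × ℝ => ((1 - |z.1| : ℝ) : ℂ) *
            Complex.exp (Complex.I * (z.1 * (l * y))) *
            ((g z.2 : ℂ) * Complex.exp (-((σ + Complex.I * (l * z.1)) * z.2))) := by fun_prop
        exact this.aestronglyMeasurable
      · rw [Measure.prod_restrict]
        refine (ae_restrict_iff' (measurableSet_uIoc.prod measurableSet_Ioi)).2 (.of_forall ?_)
        rintro ⟨u, t⟩ ⟨hu, ht⟩
        rw [uIoc_of_le (by norm_num)] at hu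
        have hu1 := abs_one_sub_abs_le_one hu
        simp only [Function.uncurry_apply_pair, norm_mul, Complex.norm_exp, Complex.norm_real,
          Real.norm_eq_abs]
        have e1 : (Complex.I * (u * (l * y) : ℂ)).re = 0 := by simp
        have e2 : (-(((σ : ℂ) + Complex.I * (l * u)) * t)).re = -σ * t := by simp
        rw [e1, e2, Real.exp_zero, mul_one]
        gcongr
        exact hB t
    _ = _ := by
      refine setIntegral_congr_fun measurableSet_Ioi fun t _ => ?_
      push_cast
      rw [fejerKernel_eq_integral, ← intervalIntegral.integral_const_mul]
      refine intervalIntegral.integral_congr fun u _ => ?_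
      push_cast
      have : Complex.exp (Complex.I * (u * (l * y))) *
          Complex.exp (-((σ + Complex.I * (l * u)) * t)) =
          Complex.exp (-(σ * t)) * Complex.exp (Complex.I * (u * (l * (y - t)))) := by
        rw [← Complex.exp_add, ← Complex.exp_add]; ring_nf
      linear_combination (1 - ((|u| : ℝ) : ℂ)) * g t * this

/-- The limit σ → 0+ of the previous identity. Compact support in u lets a bound for `H` on a
compact rectangle dominate one side; integrability of the Fejér kernel dominates the other. -/
lemma integral_boundary_mul_triangle (hg : Measurable g) (hB : ∀ t, |g t| ≤ B)
    (hH : ∀ s : ℂ, 0 < s.re → H s = ∫ t in Ioi (0 : ℝ), (g t : ℂ) * Complex.exp (-(s * t)))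
    (hHc : ContinuousOn H {s | 0 ≤ s.re}) {l : ℝ} (hl : 0 < l) (y : ℝ) :
    ∫ u in (-1 : ℝ)..1, ((1 - |u| : ℝ) : ℂ) * Complex.exp (Complex.I * (u * (l * y))) *
        H (Complex.I * (l * u)) =
      ((∫ t in Ioi (0 : ℝ), g t * fejerKernel (l * (y - t)) : ℝ) : ℂ) := by
  have hB0 : 0 ≤ B := (abs_nonneg _).trans (hB 0)
  have hcont : ContinuousOn (fun p : ℝ × ℝ => H (p.1 + Complex.I * (l * p.2)))
      (Icc 0 1 ×ˢ Icc (-1) 1) := by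
    refine hHc.comp (by fun_prop) ?_
    rintro ⟨σ, u⟩ ⟨hσ, -⟩
    simpa using hσ.1
  obtain ⟨D, hD⟩ := (isCompact_Icc.prod isCompact_Icc).exists_bound_of_continuousOn hcont
  have hmem : ∀ᶠ σ : ℝ in 𝓝[>] 0, σ ∈ Ioc (0 : ℝ) 1 := Ioc_mem_nhdsGT one_pos
  have hsec : ∀ σ ∈ Icc (0 : ℝ) 1,
      ContinuousOn (fun u : ℝ => H (σ + Complex.I * (l * u))) (Icc (-1) 1) := fun σ hσ =>
    hcont.comp (f := fun u : ℝ => (σ, u)) (by fun_prop) fun u hu => ⟨hσ, hu⟩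
  have L1 : Tendsto (fun σ : ℝ => ∫ u in (-1 : ℝ)..1, ((1 - |u| : ℝ) : ℂ) *
      Complex.exp (Complex.I * (u * (l * y))) * H (σ + Complex.I * (l * u))) (𝓝[>] 0)
      (𝓝 (∫ u in (-1 : ℝ)..1, ((1 - |u| : ℝ) : ℂ) * Complex.exp (Complex.I * (u * (l * y))) *
        H (Complex.I * (l * u)))) := by
    refine intervalIntegral.tendsto_integral_filter_of_dominated_convergence (fun _ => D) ?_ ?_ ?_ ?_
    · filter_upwards [hmem] with σ hσ
      rw [uIoc_of_le (by norm_num)]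
      refine ContinuousOn.aestronglyMeasurable ?_ measurableSet_Ioc
      refine ContinuousOn.mul (by fun_prop) ((hsec σ ⟨hσ.1.le, hσ.2⟩).mono Ioc_subset_Icc_self)
    · filter_upwards [hmem] with σ hσ
      refine .of_forall fun u hu => ?_
      rw [uIoc_of_le (by norm_num)] at hu
      have hu1 := abs_one_sub_abs_le_one hu
      have e1 : (Complex.I * (u * (l * y) : ℂ)).re = 0 := by simp
      rw [norm_mul, norm_mul, Complex.norm_exp, Complex.norm_real, Real.norm_eq_abs, e1,
        Real.exp_zero, mul_one]
      have := hD (σ, u) ⟨⟨hσ.1.le, hσ.2⟩, ⟨hu.1.le, hu.2⟩⟩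
      simp only at this
      calc _ ≤ 1 * D := by gcongr
        _ = D := one_mul D
    · simp
    · refine .of_forall fun u hu => ?_
      rw [uIoc_of_le (by norm_num)] at hu
      refine Tendsto.const_mul _ ?_
      have hc : Tendsto (fun σ : ℝ => H (σ + Complex.I * (l * u))) (𝓝[Icc 0 1] 0)
          (𝓝 (H (Complex.I * (l * u)))) := by
        have : ContinuousOn (fun σ : ℝ => H (σ + Complex.I * (l * u))) (Icc 0 1) :=
          hcont.comp (f := fun σ : ℝ => (σ, u)) (by fun_prop) fun σ hσ => ⟨hσ, ⟨hu.1.le, hu.2⟩⟩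
        simpa [ContinuousWithinAt] using this 0 (by simp)
      exact hc.mono_left (nhdsWithin_le_of_mem (mem_of_superset (Ioc_mem_nhdsGT one_pos)
        Ioc_subset_Icc_self))
  have L2 : Tendsto (fun σ : ℝ => ∫ t in Ioi (0 : ℝ),
      ((g t * Real.exp (-(σ * t)) * fejerKernel (l * (y - t)) : ℝ) : ℂ)) (𝓝[>] 0)
      (𝓝 (∫ t in Ioi (0 : ℝ), ((g t * fejerKernel (l * (y - t)) : ℝ) : ℂ))) := by
    refine tendsto_integral_filter_of_dominated_convergence
      (fun t => B * fejerKernel (l * (y - t))) ?_ ?_ ?_ ?_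
    · have := continuous_fejerKernel.measurable
      refine .of_forall fun σ => Measurable.aestronglyMeasurable (by fun_prop)
    · filter_upwards [hmem] with σ hσ
      refine (ae_restrict_iff' measurableSet_Ioi).2 (.of_forall fun t (ht : 0 < t) => ?_)
      rw [Complex.norm_real, norm_mul, norm_mul, Real.norm_of_nonneg (fejerKernel_nonneg _),
        Real.norm_of_nonneg (Real.exp_pos _).le, Real.norm_eq_abs]
      have : Real.exp (-(σ * t)) ≤ 1 := Real.exp_le_one_iff.2 (by nlinarith [hσ.1])
      refine mul_le_mul_of_nonneg_right ?_ (fejerKernel_nonneg _)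
      calc _ ≤ B * 1 := mul_le_mul (hB t) this (Real.exp_pos _).le hB0
        _ = B := mul_one B
    · exact ((integrable_fejerKernel_comp hl y).const_mul B).integrableOn
    · refine .of_forall fun t => ?_
      have : Continuous fun σ : ℝ =>
          ((g t * Real.exp (-(σ * t)) * fejerKernel (l * (y - t)) : ℝ) : ℂ) := by fun_prop
      simpa using (this.tendsto 0).mono_left (nhdsWithin_le_nhds (s := Ioi (0 : ℝ)))
  rw [← integral_complex_ofReal]
  refine tendsto_nhds_unique L1 (L2.congr' ?_)
  filter_upwards [self_mem_nhdsWithin] with σ hσ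
  exact (integral_laplace_mul_triangle hg hB hH l y hσ).symm

/-- If the Laplace transform of a bounded function extends continuously to the imaginary axis,
then the Fejér means of the function tend to zero. -/
theorem tendsto_fejerMean (hg : Measurable g) (hB : ∀ t, |g t| ≤ B)
    (hH : ∀ s : ℂ, 0 < s.re → H s = ∫ t in Ioi (0 : ℝ), (g t : ℂ) * Complex.exp (-(s * t)))
    (hHc : ContinuousOn H {s | 0 ≤ s.re}) {l : ℝ} (hl : 0 < l) :
    Tendsto (fun y => ∫ t in Ioi (0 : ℝ), g t * fejerKernel (l * (y - t))) atTop (𝓝 0) := by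
  have key : Tendsto (fun y : ℝ =>
      ((∫ t in Ioi (0 : ℝ), g t * fejerKernel (l * (y - t)) : ℝ) : ℂ)) atTop (𝓝 0) := by
    simp_rw [← integral_boundary_mul_triangle hg hB hH hHc hl]
    -- Riemann–Lebesgue applies since y enters only through the phase; the frequency -ly/(2π)
    -- matches the normalisation of the additive character.
    have RL := Real.tendsto_integral_exp_smul_cocompact
      ((Ioc (-1 : ℝ) 1).indicator fun u => ((1 - |u| : ℝ) : ℂ) * H (Complex.I * (l * u)))
    have hw : Tendsto (fun y : ℝ => -(l / (2 * Real.pi)) * y) atTop (cocompact ℝ) :=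
      (tendsto_id.const_mul_atTop_of_neg (by have := Real.pi_pos; simp; positivity)).mono_right
        atBot_le_cocompact
    refine (RL.comp hw).congr fun y => ?_
    rw [intervalIntegral.integral_of_le (by norm_num), ← integral_indicator measurableSet_Ioc]
    simp only [Function.comp_apply]
    refine integral_congr_ae (.of_forall fun u => ?_)
    by_cases hu : u ∈ Ioc (-1 : ℝ) 1
    · simp only [indicator_of_mem hu, Circle.smul_def, Real.fourierChar_apply, smul_eq_mul]
      have : ((2 * Real.pi * -(u * (-(l / (2 * Real.pi)) * y)) : ℝ) : ℂ) * Complex.I =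
          Complex.I * (u * (l * y)) := by
        have : (2 * Real.pi * -(u * (-(l / (2 * Real.pi)) * y)) : ℝ) = u * (l * y) := by
          have := Real.pi_pos
          field_simp
        rw [this]; push_cast; ring
      rw [this]; ring
    · simp only [indicator_of_notMem hu, smul_zero]
  rw [← Complex.ofReal_zero] at key
  exact (Complex.isUniformEmbedding_ofReal.isEmbedding.tendsto_nhds_iff).2 key

end FejerMean

/-! ### From Fejér means to a pointwise lower bound -/

lemma tendsto_integral_fejerKernel_tail :
    Tendsto (fun R : ℝ => ∫ v, {v : ℝ | R < |v|}.indicator fejerKernel v) atTop (𝓝 0) := by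
  have hm : ∀ R : ℝ, MeasurableSet {v : ℝ | R < |v|} := fun R =>
    measurableSet_lt measurable_const (by fun_prop)
  have := tendsto_integral_filter_of_dominated_convergence (μ := volume) (l := atTop)
    (F := fun (R : ℝ) v => {v : ℝ | R < |v|}.indicator fejerKernel v) (f := fun _ => (0 : ℝ))
    fejerKernel (.of_forall fun R =>
      (continuous_fejerKernel.measurable.indicator (hm R)).aestronglyMeasurable)
    (.of_forall fun R => .of_forall fun v => by
      rw [Real.norm_of_nonneg (indicator_nonneg (fun _ _ => fejerKernel_nonneg _) _)]
      exact indicator_le_self' (fun _ _ => fejerKernel_nonneg _) _)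
    integrable_fejerKernel (.of_forall fun v => tendsto_const_nhds.congr' (by
      filter_upwards [eventually_ge_atTop |v|] with R hR
      exact (indicator_of_notMem (by simpa using hR) _).symm))
  simpa using this

lemma tendsto_setIntegral_Ioi_fejerKernel_comp {l : ℝ} (hl : 0 < l) :
    Tendsto (fun z : ℝ => ∫ t in Ioi (0 : ℝ), fejerKernel (l * (z - t))) atTop
      (𝓝 (l⁻¹ * ∫ v, fejerKernel v)) := by
  have hcov : AECover volume atTop fun z : ℝ => Iio z := by
    simpa using aecover_Iio (μ := volume) (tendsto_id (α := ℝ) (x := atTop))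
  have := hcov.integral_tendsto_of_countably_generated
    (integrable_fejerKernel.comp_mul_left' hl.ne')
  rw [Measure.integral_comp_mul_left, abs_of_pos (inv_pos.2 hl), smul_eq_mul] at this
  refine this.congr fun z => ?_
  rw [← integral_indicator measurableSet_Iio, ← integral_indicator measurableSet_Ioi,
    ← integral_sub_left_eq_self _ volume z]
  refine integral_congr_ae (.of_forall fun t => ?_)
  simp [indicator]

/-- A Tauberian step: if `t ↦ exp t * f t` is monotone and the Fejér means of `f - 1` tend to zero,
then `liminf f ≥ 1`. -/
theorem eventually_one_sub_le_of_fejerMean {f : ℝ → ℝ} {B : ℝ} (hf : Measurable f)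
    (hf0 : ∀ t, 0 ≤ f t) (hB : ∀ t, f t ≤ B)
    (hmono : ∀ s t, s ≤ t → f s ≤ Real.exp (t - s) * f t)
    (hlim : ∀ l : ℝ, 0 < l → Tendsto (fun y => ∫ t in Ioi (0 : ℝ),
      (f t - 1) * fejerKernel (l * (y - t))) atTop (𝓝 0))
    {ε : ℝ} (hε : 0 < ε) : ∀ᶠ y in atTop, 1 - ε ≤ f y := by
  have hB0 : 0 ≤ B := (hf0 0).trans (hB 0)
  set I := ∫ v, fejerKernel v with hI
  have hI0 : 0 < I := integral_fejerKernel_pos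
  set δ := ε / 8 with hδ
  have hδ0 : 0 < δ := by positivity
  set tail : ℝ → ℝ → ℝ := fun R v => {v : ℝ | R < |v|}.indicator fejerKernel v with htail
  obtain ⟨R, hR, hR0⟩ : ∃ R : ℝ, B * (∫ v, tail R v) < I * (ε / 4) ∧ 0 < R := by
    have h1 : Tendsto (fun R => B * ∫ v, tail R v) atTop (𝓝 0) := by
      simpa using tendsto_integral_fejerKernel_tail.const_mul B
    exact ((h1.eventually_lt_const (by positivity)).and (eventually_gt_atTop 0)).exists
  have htail_int : Integrable (tail R) :=
    integrable_fejerKernel.indicator (measurableSet_lt measurable_const (by fun_prop))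
  have htail0 : ∀ v, 0 ≤ tail R v := fun v => indicator_nonneg (fun _ _ => fejerKernel_nonneg _) v
  -- With this scale, |l(y - δ - t)| ≤ R means t ∈ [y - 2δ, y]. Centring the kernel at y - δ puts
  -- its bulk to the left of y, where `hmono` gives f t ≤ e^(2δ) f y; elsewhere f ≤ B and the tail
  -- is small.
  set l := R / δ with hl
  have hl0 : 0 < l := by positivity
  have hmain : ∀ z, ∫ t in Ioi (0 : ℝ), f t * fejerKernel (l * (z - t)) =
      (∫ t in Ioi (0 : ℝ), (f t - 1) * fejerKernel (l * (z - t))) +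
        ∫ t in Ioi (0 : ℝ), fejerKernel (l * (z - t)) := by
    intro z
    have hi := (integrable_fejerKernel_comp hl0 z).integrableOn (s := Ioi 0)
    rw [← integral_add ?_ hi]
    · congr 1 with t; ring
    · refine hi.bdd_mul (c := B + 1) (by fun_prop) (.of_forall fun t => ?_)
      rw [Real.norm_eq_abs, abs_le]
      constructor <;> linarith [hf0 t, hB t]
  have hlim' : Tendsto (fun y => ∫ t in Ioi (0 : ℝ), f t * fejerKernel (l * (y - δ - t))) atTop
      (𝓝 (l⁻¹ * I)) := by
    have h2 := (hlim l hl0).add (tendsto_setIntegral_Ioi_fejerKernel_comp hl0)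
    rw [zero_add] at h2
    simp_rw [← hmain] at h2
    exact h2.comp (tendsto_atTop_add_const_right _ (-δ) tendsto_id)
  have hub : ∀ y, ∫ t in Ioi (0 : ℝ), f t * fejerKernel (l * (y - δ - t)) ≤
      l⁻¹ * (Real.exp (2 * δ) * f y * I + B * ∫ v, tail R v) := by
    intro y
    have hK := integrable_fejerKernel_comp hl0 (y - δ)
    have hT : Integrable fun t => tail R (l * (y - δ - t)) :=
      (htail_int.comp_mul_left' hl0.ne').comp_sub_left (y - δ)
    have hTi : ∫ t, tail R (l * (y - δ - t)) = l⁻¹ * ∫ v, tail R v := by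
      rw [integral_sub_left_eq_self (fun t => tail R (l * t)) volume (y - δ),
        Measure.integral_comp_mul_left, abs_of_pos (inv_pos.2 hl0), smul_eq_mul]
    have hKf : Integrable fun t => f t * fejerKernel (l * (y - δ - t)) :=
      hK.bdd_mul (c := B) hf.aestronglyMeasurable
        (.of_forall fun t => by rw [Real.norm_of_nonneg (hf0 t)]; exact hB t)
    calc _ ≤ ∫ t, f t * fejerKernel (l * (y - δ - t)) :=
          setIntegral_le_integral hKf (.of_forall fun t => mul_nonneg (hf0 t) (fejerKernel_nonneg _))
      _ ≤ ∫ t, (Real.exp (2 * δ) * f y * fejerKernel (l * (y - δ - t)) +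
            B * tail R (l * (y - δ - t))) := by
          refine integral_mono hKf ((hK.const_mul _).add (hT.const_mul B)) fun t => ?_
          have hE : 0 ≤ Real.exp (2 * δ) * f y := mul_nonneg (Real.exp_pos _).le (hf0 y)
          by_cases h : R < |l * (y - δ - t)|
          · have : tail R (l * (y - δ - t)) = fejerKernel (l * (y - δ - t)) :=
              indicator_of_mem (s := {v : ℝ | R < |v|}) h _
            simp only [this]
            nlinarith [mul_nonneg hE (fejerKernel_nonneg (l * (y - δ - t))),
              mul_le_mul_of_nonneg_right (hB t) (fejerKernel_nonneg (l * (y - δ - t)))]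
          · have h' : |y - δ - t| ≤ δ := by
              rw [abs_mul, abs_of_pos hl0, not_lt, hl, div_mul_eq_mul_div, div_le_iff₀ hδ0] at h
              exact le_of_mul_le_mul_left h hR0
            rw [abs_le] at h'
            have h3 : f t ≤ Real.exp (2 * δ) * f y :=
              (hmono t y (by linarith)).trans
                (mul_le_mul_of_nonneg_right (Real.exp_le_exp.2 (by linarith)) (hf0 y))
            nlinarith [mul_le_mul_of_nonneg_right h3 (fejerKernel_nonneg (l * (y - δ - t))),
              mul_nonneg hB0 (htail0 (l * (y - δ - t)))]
      _ = _ := by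
          rw [integral_add (hK.const_mul _) (hT.const_mul B), integral_const_mul,
            integral_const_mul, hTi, integral_fejerKernel_comp hl0]
          ring
  have hev := hlim'.eventually_const_lt
    (show l⁻¹ * (I * (1 - ε / 4)) < l⁻¹ * I by
      have : I * (1 - ε / 4) < I := by nlinarith
      exact mul_lt_mul_of_pos_left this (inv_pos.2 hl0))
  filter_upwards [hev] with y hy
  have h4 := lt_of_mul_lt_mul_left (hy.trans_le (hub y)) (inv_pos.2 hl0).le
  have h5 : 1 - ε / 2 < Real.exp (2 * δ) * f y := by
    have : I * (1 - ε / 2) < I * (Real.exp (2 * δ) * f y) := by nlinarith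
    exact lt_of_mul_lt_mul_left this hI0.le
  have h6 : 1 - 2 * δ ≤ Real.exp (-(2 * δ)) := by
    linarith [Real.add_one_le_exp (-(2 * δ))]
  have h7 : Real.exp (-(2 * δ)) * (1 - ε / 2) < f y := by
    have := mul_lt_mul_of_pos_left h5 (Real.exp_pos (-(2 * δ)))
    rwa [← mul_assoc, ← Real.exp_add, neg_add_cancel, Real.exp_zero, one_mul] at this
  have h8 : Real.exp (-(2 * δ)) ≤ 1 := Real.exp_le_one_iff.2 (by linarith)
  nlinarith

/-! ### The lower half of the prime number theorem -/

/-- The function `ψ(eᵗ) e⁻ᵗ`. -/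
noncomputable def psiExp (t : ℝ) : ℝ := Chebyshev.psi (Real.exp t) * Real.exp (-t)

lemma measurable_psiExp : Measurable psiExp :=
  (Chebyshev.psi_mono.measurable.comp Real.measurable_exp).mul (by fun_prop)

lemma psiExp_nonneg (t : ℝ) : 0 ≤ psiExp t :=
  mul_nonneg (Chebyshev.psi_nonneg _) (Real.exp_pos _).le

lemma psiExp_le (t : ℝ) : psiExp t ≤ Real.log 4 + 4 := by
  have := mul_le_mul_of_nonneg_right (Chebyshev.psi_le_const_mul_self (Real.exp_pos t).le)
    (Real.exp_pos (-t)).le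
  rwa [mul_assoc, ← Real.exp_add, add_neg_cancel, Real.exp_zero, mul_one] at this

lemma psiExp_le_exp_mul {s t : ℝ} (hst : s ≤ t) : psiExp s ≤ Real.exp (t - s) * psiExp t := by
  have : Real.exp (t - s) * psiExp t = Chebyshev.psi (Real.exp t) * Real.exp (-s) := by
    rw [psiExp, mul_left_comm, ← Real.exp_add]; ring_nf
  rw [this]
  exact mul_le_mul_of_nonneg_right (Chebyshev.psi_mono (Real.exp_le_exp.2 hst)) (Real.exp_pos _).le

/-- `-ζ'/ζ(s) - 1/(s-1)`, extended continuously to `1 ≤ re s`. -/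
noncomputable abbrev zetaLogDerivAux : ℂ → ℂ :=
  ArithmeticFunction.vonMangoldt.LFunctionResidueClassAux (1 : ZMod 1)

open ArithmeticFunction in
lemma zetaLogDerivAux_eq {s : ℂ} (hs : 1 < s.re) :
    zetaLogDerivAux s = LSeries (fun n => (Λ n : ℂ)) s - 1 / (s - 1) := by
  have h := vonMangoldt.eqOn_LFunctionResidueClassAux (q := 1) (a := 1) isUnit_one hs
  have h1 : vonMangoldt.residueClass (1 : ZMod 1) = fun n => Λ n := by
    ext n
    exact indicator_of_mem (s := {n : ℕ | (n : ZMod 1) = 1}) (Subsingleton.elim (n : ZMod 1) 1) _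
  simpa [h1] using h

open ArithmeticFunction in
-- Partial summation, justified by Chebyshev's bound ψ(n) = O(n).
lemma LSeries_vonMangoldt_eq_integral_psi {s : ℂ} (hs : 1 < s.re) :
    LSeries (fun n => (Λ n : ℂ)) s =
      s * ∫ x in Ioi (1 : ℝ), (Chebyshev.psi x : ℂ) * (x : ℂ) ^ (-(s + 1)) := by
  have hpsi : ∀ n : ℕ, ∑ k ∈ Finset.Icc 1 n, Λ k = Chebyshev.psi n := fun n => by
    simp [Chebyshev.psi, ← Finset.Icc_add_one_left_eq_Ioc]
  rw [LSeries_eq_mul_integral_of_nonneg (fun n => Λ n) zero_le_one hs ?_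
    fun n => vonMangoldt_nonneg]
  · congr 1
    refine setIntegral_congr_fun measurableSet_Ioi fun x _ => ?_
    rw [Chebyshev.psi_eq_psi_coe_floor, ← hpsi]
    push_cast
    rfl
  · simp_rw [hpsi]
    refine Asymptotics.IsBigO.of_bound (Real.log 4 + 4) (.of_forall fun n => ?_)
    rw [Real.norm_of_nonneg (Chebyshev.psi_nonneg _), Real.rpow_one,
      Real.norm_of_nonneg n.cast_nonneg]
    exact Chebyshev.psi_le_const_mul_self n.cast_nonneg

/-- Substitution x = eᵗ. -/
lemma integral_psi_mul_cpow_eq (s : ℂ) :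
    ∫ x in Ioi (1 : ℝ), (Chebyshev.psi x : ℂ) * (x : ℂ) ^ (-(1 + s + 1)) =
      ∫ t in Ioi (0 : ℝ), (psiExp t : ℂ) * Complex.exp (-(s * t)) := by
  have himg : Real.exp '' Ioi 0 = Ioi 1 := by
    ext x
    constructor
    · rintro ⟨t, ht, rfl⟩
      exact Real.one_lt_exp_iff.2 ht
    · intro (hx : 1 < x)
      exact ⟨Real.log x, Real.log_pos hx, Real.exp_log (by linarith)⟩
  rw [← himg, integral_image_eq_integral_abs_deriv_smul measurableSet_Ioi
    (fun t _ => (Real.hasDerivAt_exp t).hasDerivWithinAt) Real.exp_injective.injOn]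
  refine setIntegral_congr_fun measurableSet_Ioi fun t _ => ?_
  rw [abs_of_pos (Real.exp_pos t), Complex.real_smul,
    Complex.cpow_def_of_ne_zero (by exact_mod_cast (Real.exp_pos t).ne'),
    ← Complex.ofReal_log (Real.exp_pos t).le, Real.log_exp, psiExp]
  push_cast
  have : Complex.exp t * Complex.exp (t * (-(1 + s + 1))) =
      Complex.exp (-t) * Complex.exp (-(s * t)) := by
    rw [← Complex.exp_add, ← Complex.exp_add]; ring_nf
  linear_combination (Chebyshev.psi (Real.exp t) : ℂ) * this

/-- Subtracting 1 from `psiExp` removes the pole 1/s: since 1/s + 1 = (1 + s)/s, what remains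
involves only the regularised logarithmic derivative. -/
lemma laplace_psiExp_sub_one {s : ℂ} (hs : 0 < s.re) :
    (zetaLogDerivAux (1 + s) - 1) / (1 + s) =
      ∫ t in Ioi (0 : ℝ), ((psiExp t - 1 : ℝ) : ℂ) * Complex.exp (-(s * t)) := by
  have hs1 : 1 < (1 + s).re := by simpa using hs
  have hs0 : s ≠ 0 := fun h => by simp [h] at hs
  have hs2 : 1 + s ≠ 0 := fun h => by rw [h] at hs1; simp at hs1; linarith
  have hexp : IntegrableOn (fun t : ℝ => Complex.exp (-(s * t))) (Ioi 0) := by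
    simpa using integrableOn_exp_mul_complex_Ioi (a := -s) (by simpa using hs) 0
  have hint : ∫ t in Ioi (0 : ℝ), Complex.exp (-(s * t)) = 1 / s := by
    have := integral_exp_mul_complex_Ioi (a := -s) (by simpa using hs) 0
    simp only [neg_mul, Complex.ofReal_zero, mul_zero, Complex.exp_zero, neg_div_neg_eq] at this
    simpa using this
  have hpint : IntegrableOn (fun t : ℝ => (psiExp t : ℂ) * Complex.exp (-(s * t))) (Ioi 0) := by
    have := measurable_psiExp
    refine Integrable.bdd_mul (c := Real.log 4 + 4) hexp
      (Measurable.aestronglyMeasurable (by fun_prop)) (.of_forall fun t => ?_)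
    rw [Complex.norm_real, Real.norm_of_nonneg (psiExp_nonneg t)]
    exact psiExp_le t
  have hsplit : ∫ t in Ioi (0 : ℝ), ((psiExp t - 1 : ℝ) : ℂ) * Complex.exp (-(s * t)) =
      (∫ t in Ioi (0 : ℝ), (psiExp t : ℂ) * Complex.exp (-(s * t))) - 1 / s := by
    rw [← hint, ← integral_sub hpint hexp]
    congr 1 with t
    push_cast; ring
  rw [hsplit, zetaLogDerivAux_eq hs1, LSeries_vonMangoldt_eq_integral_psi hs1,
    integral_psi_mul_cpow_eq, add_sub_cancel_left]
  field_simp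
  ring

theorem eventually_one_sub_le_psiExp {ε : ℝ} (hε : 0 < ε) : ∀ᶠ t in atTop, 1 - ε ≤ psiExp t := by
  have hc : ContinuousOn (fun s : ℂ => (zetaLogDerivAux (1 + s) - 1) / (1 + s))
      {s | 0 ≤ s.re} := by
    -- This continuity up to re s = 1 encodes the nonvanishing of ζ on that line.
    have h1 : ContinuousOn (fun s : ℂ => zetaLogDerivAux (1 + s)) {s | 0 ≤ s.re} :=
      (ArithmeticFunction.vonMangoldt.continuousOn_LFunctionResidueClassAux (1 : ZMod 1)).comp
        (by fun_prop) fun s (hs : 0 ≤ s.re) => by simpa using hs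
    refine (h1.sub continuousOn_const).div (by fun_prop) fun s (hs : 0 ≤ s.re) h => ?_
    have := congrArg Complex.re h
    simp at this
    linarith
  refine eventually_one_sub_le_of_fejerMean measurable_psiExp psiExp_nonneg psiExp_le
    (fun s t => psiExp_le_exp_mul) (fun l hl => ?_) hε
  refine tendsto_fejerMean (B := Real.log 4 + 4) (measurable_psiExp.sub_const 1) (fun t => ?_)
    (fun s hs => laplace_psiExp_sub_one hs) hc hl
  have := Real.log_nonneg (show (1 : ℝ) ≤ 4 by norm_num)
  rw [abs_le]
  constructor <;> linarith [psiExp_nonneg t, psiExp_le t]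

/-- The lower bound in the prime number theorem for `ψ`. -/
theorem eventually_one_sub_mul_le_psi {ε : ℝ} (hε : 0 < ε) :
    ∀ᶠ x in atTop, (1 - ε) * x ≤ Chebyshev.psi x := by
  filter_upwards [Real.tendsto_log_atTop.eventually (eventually_one_sub_le_psiExp hε),
    eventually_gt_atTop 0] with x hx hx0
  rw [psiExp, Real.exp_neg, Real.exp_log hx0, ← div_eq_mul_inv, le_div_iff₀ hx0] at hx
  exact hx

/-- The lower bound in the prime number theorem. -/
theorem eventually_one_sub_mul_le_primeCounting {ε : ℝ} (hε : 0 < ε) :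
    ∀ᶠ x : ℝ in atTop, (1 - ε) * (x / Real.log x) ≤ Nat.primeCounting ⌊x⌋₊ := by
  filter_upwards [eventually_one_sub_mul_le_psi hε, eventually_gt_atTop 1] with x hx hx1
  rw [← mul_div_assoc, div_le_iff₀ (Real.log_pos hx1)]
  exact hx.trans (Chebyshev.psi_le_primeCounting_mul_log' x)

/-! ### Counting prime tuples in sliding windows -/

/-- The odd primes up to `X`. -/
def oddPrimesLE (X : ℕ) : Finset ℕ := (Finset.Iic X).filter fun p => p.Prime ∧ p ≠ 2

lemma primeCounting_le_card_oddPrimesLE_add_one (X : ℕ) :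
    Nat.primeCounting X ≤ (oddPrimesLE X).card + 1 := by
  rw [← Nat.primesLE_card_eq_primeCounting]
  refine (Finset.card_le_card fun p hp => ?_).trans (Finset.card_insert_le 2 (oddPrimesLE X))
  rw [Nat.mem_primesLE] at hp
  simp only [oddPrimesLE, Finset.mem_insert, Finset.mem_filter, Finset.mem_Iic]
  tauto

/-- The elements `p` of `Q` whose half `⌊p / 2⌋` lies in the interval `(j - N, j]`. -/
def halfWindow (Q : Finset ℕ) (N j : ℕ) : Finset ℕ :=
  Q.filter fun p => p / 2 ≤ j ∧ j < p / 2 + N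

/-- Double counting: p lies in exactly the N windows j = p/2, …, p/2 + N - 1, all of which occur in
the range. -/
lemma sum_card_halfWindow (Q : Finset ℕ) (N L : ℕ) (hQ : ∀ p ∈ Q, p / 2 < L) :
    ∑ j ∈ Finset.range (L + N), (halfWindow Q N j).card = N * Q.card := by
  simp_rw [halfWindow, Finset.card_filter]
  rw [Finset.sum_comm, mul_comm, ← smul_eq_mul, ← Finset.sum_const]
  refine Finset.sum_congr rfl fun p hp => ?_
  rw [← Finset.card_filter]
  have : (Finset.range (L + N)).filter (fun j => p / 2 ≤ j ∧ j < p / 2 + N) =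
      Finset.Ico (p / 2) (p / 2 + N) := by
    ext j
    have := hQ p hp
    simp only [Finset.mem_filter, Finset.mem_range, Finset.mem_Ico]
    omega
  rw [this, Nat.card_Ico]
  omega

/-- Tuples of odd primes up to `X` with common window index `j` are either constant, or determined
by the position and the value of a least entry, a nonzero shift tuple, and the index `j`. -/
lemma sum_card_halfWindow_pow_le (k N J X : ℕ) :
    ∑ j ∈ Finset.range J, (halfWindow (oddPrimesLE X) N j).card ^ (k + 1) ≤
      N * (oddPrimesLE X).card + (k + 1) * ∑ h ∈ shiftTuples k N,
        ((Finset.Iic X).filter fun p => p.Prime ∧ ∀ i, (p + 2 * h i).Prime).card *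
          (N - tupleMax h) := by
  classical
  set Q := oddPrimesLE X with hQ
  let T : Finset (Σ _ : ℕ, Fin (k + 1) → ℕ) :=
    (Finset.range J).sigma fun j => Fintype.piFinset fun _ => halfWindow Q N j
  let A : Finset (Σ _ : ℕ, Fin (k + 1) → ℕ) :=
    (Q ×ˢ Finset.range N).image fun a => ⟨a.1 / 2 + a.2, fun _ => a.1⟩
  -- Only the least entry is kept below X; dropping that bound on the others is harmless for an
  -- upper estimate. The last coordinate r recovers the window as j = p/2 + M(h) + r.
  let S : Finset (Σ _ : Fin k → ℕ, ℕ × ℕ) := (shiftTuples k N).sigma fun h =>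
    ((Finset.Iic X).filter fun p => p.Prime ∧ ∀ i, (p + 2 * h i).Prime) ×ˢ
      Finset.range (N - tupleMax h)
  let U : Fin (k + 1) → Finset (Σ _ : ℕ, Fin (k + 1) → ℕ) := fun i =>
    S.image fun b => ⟨b.2.1 / 2 + tupleMax b.1 + b.2.2,
      i.insertNth b.2.1 fun l => b.2.1 + 2 * b.1 l⟩
  have hT : T.card = ∑ j ∈ Finset.range J, (halfWindow Q N j).card ^ (k + 1) := by
    simp [T, Finset.card_sigma]
  have hA : A.card ≤ N * Q.card := by
    refine Finset.card_image_le.trans ?_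
    rw [Finset.card_product, Finset.card_range, mul_comm]
  have hU : (Finset.univ.biUnion U).card ≤ (k + 1) * S.card := by
    refine Finset.card_biUnion_le.trans ?_
    refine (Finset.sum_le_card_nsmul _ _ S.card fun i _ => Finset.card_image_le).trans ?_
    simp
  have hS : S.card = ∑ h ∈ shiftTuples k N,
      ((Finset.Iic X).filter fun p => p.Prime ∧ ∀ i, (p + 2 * h i).Prime).card *
        (N - tupleMax h) := by
    simp [S, Finset.card_sigma, Finset.card_product]
  rw [← hT, ← hS]
  refine (Finset.card_le_card fun t ht => ?_).trans
    ((Finset.card_union_le A (Finset.univ.biUnion U)).trans (add_le_add hA hU))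
  obtain ⟨j, f⟩ := t
  simp only [T, Finset.mem_sigma, Finset.mem_range, Fintype.mem_piFinset, halfWindow,
    Finset.mem_filter] at ht
  obtain ⟨-, hf⟩ := ht
  have hprime : ∀ i, f i ≤ X ∧ (f i).Prime ∧ f i % 2 = 1 := fun i => by
    have := (hf i).1
    simp only [hQ, oddPrimesLE, Finset.mem_filter, Finset.mem_Iic] at this
    exact ⟨this.1, this.2.1, this.2.1.eq_two_or_odd.resolve_left this.2.2⟩
  obtain ⟨i, hi⟩ := Finite.exists_min f
  rw [Finset.mem_union]
  by_cases hconst : ∀ l, f l = f i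
  · left
    refine Finset.mem_image.2 ⟨(f i, j - f i / 2), ?_, ?_⟩
    · rw [Finset.mem_product, Finset.mem_range]
      exact ⟨(hf i).1, by have := (hf i).2; simp only; omega⟩
    · have h1 : f i / 2 + (j - f i / 2) = j := by have := (hf i).2; omega
      have h2 : (fun _ => f i) = f := funext fun l => (hconst l).symm
      simp only [h1, h2]
  · right
    let h : Fin k → ℕ := fun l => (f (i.succAbove l) - f i) / 2
    -- All entries are odd, so their differences are even and halving loses nothing; this is why 2
    -- was excluded.
    have hh : ∀ l, f i + 2 * h l = f (i.succAbove l) := fun l => by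
      have h1 := (hprime i).2.2
      have h2 := (hprime (i.succAbove l)).2.2
      have h3 := hi (i.succAbove l)
      simp only [h]
      omega
    have hj : ∀ l, f i / 2 + h l ≤ j := fun l => by
      have h1 := (hf (i.succAbove l)).2.1
      rw [← hh l] at h1
      omega
    have hi2 := (hf i).2
    have hmax : tupleMax h ≤ j - f i / 2 := Finset.sup_le fun l _ => by
      have := hj l
      omega
    refine Finset.mem_biUnion.2 ⟨i, Finset.mem_univ _, Finset.mem_image.2
      ⟨⟨h, f i, j - f i / 2 - tupleMax h⟩, ?_, ?_⟩⟩
    · simp only [S, Finset.mem_sigma, Finset.mem_product, Finset.mem_filter, Finset.mem_Iic,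
        Finset.mem_range, shiftTuples, Fintype.mem_piFinset]
      refine ⟨⟨fun l => ?_, ?_⟩, ⟨(hprime i).1, (hprime i).2.1, fun l => ?_⟩, ?_⟩
      · have := hj l
        omega
      · by_contra! hz
        refine hconst fun l => ?_
        rcases Fin.eq_self_or_eq_succAbove i l with rfl | ⟨m, rfl⟩
        · rfl
        · rw [← hh m, hz m, mul_zero, add_zero]
      · rw [hh l]
        exact (hprime _).2.1
      · omega
    · have h1 : f i / 2 + tupleMax h + (j - f i / 2 - tupleMax h) = j := by omega
      have h2 : (i.insertNth (f i) fun l => f i + 2 * h l : Fin (k + 1) → ℕ) = f := by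
        rw [Fin.insertNth_eq_iff]
        exact ⟨rfl, funext hh⟩
      simp only [h1, h2]

lemma tupleMax_le_of_mem_shiftTuples {k N : ℕ} {h : Fin k → ℕ} (hh : h ∈ shiftTuples k N) :
    tupleMax h ≤ N := by
  simp only [shiftTuples, Finset.mem_filter, Fintype.mem_piFinset, Finset.mem_Iic] at hh
  exact Finset.sup_le fun l _ => hh.1 l

/-- The power mean inequality for the numbers of odd primes in short intervals. -/
lemma card_oddPrimesLE_mul_sub_le_weightedTupleAverage (k : ℕ) {E x : ℝ} (hx : 0 ≤ x)
    (hE : 1 ≤ ⌊E⌋₊) :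
    ((oddPrimesLE ⌊x⌋₊).card : ℝ) *
        (((oddPrimesLE ⌊x⌋₊).card / (x + 2 + 2 * ⌊E⌋₊)) ^ k - (1 / (2 * ⌊E⌋₊)) ^ k) ≤
      weightedTupleAverage k E x := by
  set N := ⌊E⌋₊ with hN
  set P := (oddPrimesLE ⌊x⌋₊).card with hP
  set L := ⌊x⌋₊ / 2 + 1 with hL
  have hN0 : (0 : ℝ) < N := by exact_mod_cast hE
  have hcomb := sum_card_halfWindow_pow_le k N (L + N) ⌊x⌋₊
  have hsum := sum_card_halfWindow (oddPrimesLE ⌊x⌋₊) N L fun p hp => by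
    simp only [oddPrimesLE, Finset.mem_filter, Finset.mem_Iic] at hp
    omega
  have hmean := pow_sum_div_card_le_sum_pow (s := Finset.range (L + N))
    (f := fun j => ((halfWindow (oddPrimesLE ⌊x⌋₊) N j).card : ℝ)) (n := k)
    fun _ _ => Nat.cast_nonneg _
  rw [Finset.card_range, ← Nat.cast_sum, hsum] at hmean
  set W := ∑ h ∈ shiftTuples k N,
      ((N : ℝ) - (tupleMax h : ℝ)) * (primeTupleCount (fun i => 2 * h i) x : ℝ) with hW
  have hcomb' : ∑ j ∈ Finset.range (L + N),
      ((halfWindow (oddPrimesLE ⌊x⌋₊) N j).card : ℝ) ^ (k + 1) ≤ N * P + (k + 1) * W := by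
    have hc : (N * P + (k + 1) * W : ℝ) = ((N * P + (k + 1) * ∑ h ∈ shiftTuples k N,
        ((Finset.Iic ⌊x⌋₊).filter fun p => p.Prime ∧ ∀ i, (p + 2 * h i).Prime).card *
          (N - tupleMax h) : ℕ) : ℝ) := by
      push_cast
      congr 2
      refine Finset.sum_congr rfl fun h hh => ?_
      rw [Nat.cast_sub (tupleMax_le_of_mem_shiftTuples hh), mul_comm, primeTupleCount]
    rw [hc]
    exact_mod_cast hcomb
  have h1 := hmean.trans hcomb'
  -- Windows index halves of primes, so there are about x/2 + N of them; this supplies the factor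
  -- 2^k.
  have hLN : 2 * ((L + N : ℕ) : ℝ) ≤ x + 2 + 2 * N := by
    have h2 : 2 * L ≤ ⌊x⌋₊ + 2 := by omega
    have h3 : (2 * L : ℝ) ≤ ⌊x⌋₊ + 2 := by exact_mod_cast h2
    have h4 := Nat.floor_le hx
    push_cast
    linarith
  have hLN0 : (0 : ℝ) < ((L + N : ℕ) : ℝ) := by
    have : 0 < L + N := by omega
    exact_mod_cast this
  have h5 : (N : ℝ) ^ (k + 1) * 2 ^ k * (P * (P / (x + 2 + 2 * N)) ^ k) ≤
      (N * P + (k + 1) * W : ℝ) := by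
    refine le_trans ?_ h1
    calc (N : ℝ) ^ (k + 1) * 2 ^ k * (P * (P / (x + 2 + 2 * N)) ^ k)
        ≤ (N : ℝ) ^ (k + 1) * 2 ^ k * (P * (P / (2 * ((L + N : ℕ) : ℝ))) ^ k) := by
          gcongr
      _ = _ := by
          rw [div_pow, mul_pow, Nat.cast_mul, mul_pow, pow_succ (P : ℝ)]
          field_simp
  have h6 : weightedTupleAverage k E x = ((k + 1) * W) / ((N : ℝ) ^ (k + 1) * 2 ^ k) := by
    rw [weightedTupleAverage, ← hN, ← hW]
    ring
  have h7 : (P : ℝ) * (1 / (2 * N)) ^ k = (N * P) / ((N : ℝ) ^ (k + 1) * 2 ^ k) := by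
    rw [div_pow, mul_pow, one_pow, pow_succ]
    field_simp
  rw [h6, mul_sub, h7, sub_le_iff_le_add, ← add_div, le_div_iff₀ (by positivity)]
  linarith

/-! ### Asymptotics -/

theorem mainTheorem5 (k : ℕ) (hk : 1 ≤ k) (C : ℝ) (hC : 1 / 2 < C) (E : ℝ → ℝ)
    (hE_lower : ∀ᶠ x in Filter.atTop, C * Real.log x ≤ E x)
    (hE_upper : Asymptotics.IsLittleO Filter.atTop E
      (fun x : ℝ => x / Real.log x ^ (k + 1))) :
    ∀ ε : ℝ, 0 < ε → ∀ᶠ x in Filter.atTop,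
      (1 - ε) * ((1 - 1 / (2 * C) ^ k) * (x / Real.log x ^ (k + 1))) ≤
        weightedTupleAverage k (E x) x := by
  intro ε hε
  have hC0 : 0 < C := by linarith
  set A : ℝ := 1 - 1 / (2 * C) ^ k with hA
  have hA0 : 0 < A := by
    have : 1 < (2 * C) ^ k := one_lt_pow₀ (by linarith) (by omega)
    rw [hA, sub_pos, div_lt_one (by positivity)]
    exact this
  -- `b η` is the bracket after relative losses: η in the prime count, η in x + 2 + 2N, and η in N ≥
  -- (1 - η) C log x. It tends to `A` as η → 0.
  set b : ℝ → ℝ := fun η => ((1 - η) / (1 + η)) ^ k - (1 / (2 * C * (1 - η))) ^ k with hb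
  have hbc : ContinuousAt b 0 := by
    refine ContinuousAt.sub (ContinuousAt.pow (ContinuousAt.div (by fun_prop) (by fun_prop)
      (by norm_num)) k) (ContinuousAt.pow (ContinuousAt.div (by fun_prop) (by fun_prop) ?_) k)
    simpa using hC0.ne'
  have hb0 : b 0 = A := by simp [hb, hA, mul_pow, mul_comm]
  obtain ⟨η, ⟨hη1, hη2⟩, hη3⟩ : ∃ η : ℝ, (0 < b η ∧ (1 - ε) * A < (1 - η) * b η) ∧
      η ∈ Ioo (0 : ℝ) 1 := by
    have e1 : ∀ᶠ η in 𝓝 (0 : ℝ), 0 < b η := hbc.eventually_const_lt (by rwa [hb0])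
    have e2 : ∀ᶠ η in 𝓝 (0 : ℝ), (1 - ε) * A < (1 - η) * b η := by
      have : ContinuousAt (fun η => (1 - η) * b η) 0 := ContinuousAt.mul (by fun_prop) hbc
      exact this.eventually_const_lt (by simp only [hb0]; nlinarith)
    exact (((e1.and e2).filter_mono nhdsWithin_le_nhds).and
      (Ioo_mem_nhdsGT (zero_lt_one (α := ℝ)))).exists
  obtain ⟨hη0, hη4⟩ := hη3
  have hlog := Real.tendsto_log_atTop
  have hdiv : Tendsto (fun x : ℝ => x / Real.log x) atTop atTop := by
    have h1 : Tendsto (fun x : ℝ => Real.log x / x) atTop (𝓝[>] 0) := by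
      refine tendsto_nhdsWithin_iff.2 ⟨Real.isLittleO_log_id_atTop.tendsto_div_nhds_zero, ?_⟩
      filter_upwards [eventually_gt_atTop 1] with x hx
      exact div_pos (Real.log_pos hx) (by linarith)
    refine (tendsto_inv_nhdsGT_zero.comp h1).congr fun x => ?_
    simp
  -- The thresholds absorb, in order from 2/η on: the missing prime 2; log x ≥ 1 for the bound on N;
  -- the floor of E; N ≥ 1; and the 2 in x + 2 + 2N.
  filter_upwards [hE_lower, hE_upper.bound (show 0 < η / 4 by positivity),
    eventually_one_sub_mul_le_primeCounting (show 0 < η / 2 by positivity),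
    hdiv.eventually_ge_atTop (2 / η), hlog.eventually_ge_atTop 1,
    hlog.eventually_ge_atTop (1 / (η * C)), hlog.eventually_ge_atTop (2 / C),
    eventually_ge_atTop (4 / η)] with x hx1 hx2 hx3 hx4 hx5 hx6 hx7 hx8
  have hx0 : 0 < x := lt_of_lt_of_le (by positivity) hx8
  set l := Real.log x with hl
  have hl0 : 0 < l := by linarith
  set N := ⌊E x⌋₊ with hN
  set P := (oddPrimesLE ⌊x⌋₊).card with hP
  have hE0 : 0 ≤ E x := le_trans (by positivity) hx1
  have hN1 : (1 - η) * (C * l) ≤ N := by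
    have h1 := Nat.sub_one_lt_floor (E x)
    rw [div_le_iff₀ (by positivity)] at hx6
    rw [← hN] at h1
    nlinarith
  have hNpos : 1 ≤ N := by
    refine Nat.le_floor ?_
    rw [div_le_iff₀ hC0] at hx7
    push_cast
    linarith
  have hNle : (N : ℝ) ≤ η / 4 * x := by
    refine (Nat.floor_le hE0).trans ((le_abs_self _).trans (hx2.trans ?_))
    rw [Real.norm_of_nonneg (by positivity)]
    gcongr
    exact div_le_self hx0.le (one_le_pow₀ hx5)
  have hden : x + 2 + 2 * N ≤ (1 + η) * x := by
    rw [div_le_iff₀ hη0] at hx8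
    linarith
  have hPge : (1 - η) * (x / l) ≤ P := by
    have h1 : (Nat.primeCounting ⌊x⌋₊ : ℝ) ≤ P + 1 := by
      exact_mod_cast primeCounting_le_card_oddPrimesLE_add_one ⌊x⌋₊
    rw [div_le_iff₀ hη0] at hx4
    linarith
  have hkey := card_oddPrimesLE_mul_sub_le_weightedTupleAverage k hx0.le hNpos
  rw [← hP, ← hN] at hkey
  have h1η : 0 < 1 - η := by linarith
  have hfrac : (1 - η) / (1 + η) / l ≤ P / (x + 2 + 2 * N) := by
    calc (1 - η) / (1 + η) / l = (1 - η) * (x / l) / ((1 + η) * x) := by field_simp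
      _ ≤ P / ((1 + η) * x) := by gcongr
      _ ≤ P / (x + 2 + 2 * N) := by gcongr
  have hinv : 1 / (2 * (N : ℝ)) ≤ 1 / (2 * C * (1 - η)) / l := by
    rw [div_div]
    refine one_div_le_one_div_of_le (by positivity) ?_
    linarith
  have hbr : b η / l ^ k ≤ (P / (x + 2 + 2 * N)) ^ k - (1 / (2 * (N : ℝ))) ^ k := by
    rw [hb, sub_div, ← div_pow, ← div_pow]
    gcongr
  calc (1 - ε) * (A * (x / l ^ (k + 1))) = (1 - ε) * A * (x / l ^ (k + 1)) := by ring
    _ ≤ (1 - η) * b η * (x / l ^ (k + 1)) := by gcongr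
    _ = (1 - η) * (x / l) * (b η / l ^ k) := by rw [pow_succ]; field_simp
    _ ≤ P * ((P / (x + 2 + 2 * N)) ^ k - (1 / (2 * (N : ℝ))) ^ k) := by gcongr
    _ ≤ _ := hkey
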